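/- Let $\mathcal X=\{1,\dots,n_1\}$, $\mathcal Y=\{1,\dots,n_2\}$, and let $W=(W_x)_{x\in\mathcal X}$ be a channel (each $W_x$ a probability distribution on $\mathcal Y$) whose rows $W_1,\dots,W_{n_1}$ are linearly independent. Write $H(p)=-\sum p\log p$, $D(p\|q)=\sum p(\log p-\log q)$, $(W\cdot q)(y)=\sum_x W_x(y)q(x)$, $(W\times q)(x,y)=W_x(y)q(x)$; the capacity of $W$ is $\max_q D(W\times q\|q\times(W\cdot q))$ over all distributions $q$ on $\mathcal X$. For a smooth convex $F$ let $\nabla F$ be its gradient (a row vector) and $D^F(\theta\|\theta')=\langle\nabla F(\theta),\theta-\theta'\rangle-F(\theta)+F(\theta')$. Let $f_1,\dots,f_{n_2-1}$ be linearly independent functions on $\mathcal Y$, with no nonzero constant in their span, such that $\sum_y f_j(y)W_{n_1}(y)=0$ for all $j$. Put $h_{i,j}=\sum_y f_j(y)W_i(y)$ and let $H=(h_{i,j})$ be the $(n_1-1)\times(n_2-1)$ matrix with $i\le n_1-1$, $j\le n_2-1$. For $\theta_a\in\mathbb R^{n_1-1}$, $\theta_b\in\mathbb R^{n_2-1}$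 put $F_{E,a}(\theta_a)=\log\sum_x e^{\sum_i\theta_a^i\delta_i(x)}$, $F_{E,b}(\theta_b)=\log\sum_y e^{\sum_j\theta_b^jf_j(y)}$, $\bar P_{\theta_a,X}(x)=e^{\sum_i\theta_a^i\delta_i(x)-F_{E,a}(\theta_a)}$, $\bar P_{\theta_b,Y}(y)=e^{\sum_j\theta_b^jf_j(y)-F_{E,b}(\theta_b)}$. For $\theta=((\theta^i)_{i\le n_1-1},(\theta^{(i,j)})_{i\le n_1,\,j\le n_2-1})\in\mathbb R^{n_1n_2-1}$ put $\langle\theta,\xi(x,y)\rangle=\sum_{i\le n_1-1}\theta^i\delta_i(x)+\sum_{i\le n_1,\,j\le n_2-1}\theta^{(i,j)}(f_j(y)-h_{i,j})\delta_i(x)$, $F(\theta)=\log\sum_{x,y}e^{\langle\theta,\xi(x,y)\rangle}$ and $P_{\theta,XY}(x,y)=e^{\langle\theta,\xi(x,y)\rangle-F(\theta)}$. Let $\mathcal M=\{\theta:\partial_{(i,j)}F(\theta)=0\text{ for all }i\le n_1,\,j\le n_2-1\}$, and let $\mathcal E$ be the image of the linear map $V$ which sends $(\theta_a,\theta_b)$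 to the $\theta$ with $\theta^i=\theta_a^i+(H\theta_b)^i$ and $\theta^{(i,j)}=\theta_b^j$. Let $\theta_a^\dagger\in\mathbb R^{n_1-1}$ have the components $\theta^{i,\dagger}=H(W_{n_1})-H(W_i)$. A vector $\theta_b^\dagger\in\mathbb R^{n_1(n_2-1)}$ represents $W$ if $W_i(y)=e^{\sum_j\theta^{(i,j),\dagger}(f_j(y)-h_{i,j})}\big/\sum_{y'}e^{\sum_j\theta^{(i,j),\dagger}(f_j(y')-h_{i,j})}$ for all $i,y$. Then the rank of the matrix $H$ is $n_1-1$, $F_{E,b}$ is convex, and if all $W_x(y)>0$ there is exactly one $\theta_b^\dagger$ that represents $W$. Let moreover $\theta_b^\ddagger\in\mathbb R^{n_2-1}$ satisfy $H\theta_b^\ddagger=\theta_a^\dagger$ and let $G$ be an $(n_2-1)\times(n_2-n_1)$ matrix with $\operatorname{Im}G=\operatorname{Ker}H$. If every $y$ has $W_x(y)>0$ for some $x$, then $\theta_c\mapsto F_{E,b}(\theta_b^\ddagger+G\theta_c)$ has exactly one minimizer on $\mathbb R^{n_2-n_1}$. Whenever $\theta_c^\ddagger$ is a minimizer, $\bar\theta_b^\ddagger:=\theta_b^\ddagger+G\theta_c^\ddagger$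 is the only element of the intersection of $\{\theta_b^\ddagger+G\theta_c\mid\theta_c\in\mathbb R^{n_2-n_1}\}$ and $\{\theta_b\mid\nabla F_{E,b}(\theta_b)\,G=0\}$, and for every $\theta_a^\ddagger\in\mathbb R^{n_1-1}$: (1) $\nabla F_{E,b}(\bar\theta_b^\ddagger)=\nabla F_{E,a}(\theta_a^\ddagger)\,H$ if and only if $W\cdot\bar P_{\theta_a^\ddagger,X}=\bar P_{\bar\theta_b^\ddagger,Y}$. (2) If these conditions hold, then $\bar P_{\theta_a^\ddagger,X}$ is the unique capacity-achieving input distribution, and the capacity of $W$ is $-H(W_{n_1})+F_{E,b}(\bar\theta_b^\ddagger)$. (3) If these conditions hold and $\theta_b^\dagger$ represents $W$, then $\theta^*:=(\theta_a^\ddagger+\theta_a^\dagger,\theta_b^\dagger)$ lies in $\mathcal M$, $P_{\theta^*,XY}=W\times\bar P_{\theta_a^\ddagger,X}$, and $\theta^*$ is the unique maximizer over $\theta\in\mathcal M$ of $\min_{\theta'\in\mathcal E}D^F(\theta\|\theta')$. At $\theta=\theta^*$ this minimum is attained at $\theta'=V(\theta_a^\ddagger,\bar\theta_b^\ddagger)$,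 for which $P_{\theta',XY}=\bar P_{\theta_a^\ddagger,X}\times\bar P_{\bar\theta_b^\ddagger,Y}$, and the maximum is $D(P_{\theta^*,XY}\|\bar P_{\theta_a^\ddagger,X}\times\bar P_{\bar\theta_b^\ddagger,Y})=-H(W_{n_1})+F_{E,b}(\bar\theta_b^\ddagger)$. -/

import Mathlib

open scoped BigOperators Matrix

namespace ClassicalChannel

noncomputable section

/-! ### Bregman divergence system on `ℝ^ι` -/

/-- The vector `(∂_j F(θ))_j` of partial derivatives (the mixture parameter of `θ`). -/
def grad {ι : Type*} [Fintype ι] [DecidableEq ι] (F : (ι → ℝ) → ℝ) (θ : ι → ℝ) : ι → ℝ :=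
  fun j => fderiv ℝ F θ (Pi.single j 1)

/-- Bregman divergence `D^F(θ₁ ‖ θ₂) = ⟨∇F(θ₁), θ₁ - θ₂⟩ - F(θ₁) + F(θ₂)`. -/
def bregman {ι : Type*} [Fintype ι] [DecidableEq ι] (F : (ι → ℝ) → ℝ) (θ₁ θ₂ : ι → ℝ) : ℝ :=
  grad F θ₁ ⬝ᵥ (θ₁ - θ₂) - F θ₁ + F θ₂

/-! ### Distributions on finite sets and channels -/

/-- Shannon entropy `H(p) = -∑ p log p` (natural logarithm). -/
def entropy {α : Type*} [Fintype α] (p : α → ℝ) : ℝ := ∑ a, Real.negMulLog (p a)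

/-- Relative entropy `D(p ‖ q) = ∑ p (log p - log q)`. It is only used when `q a = 0` implies
`p a = 0`; a term with `p a = 0` is zero. -/
def relEntropy {α : Type*} [Fintype α] (p q : α → ℝ) : ℝ :=
  ∑ a, p a * (Real.log (p a) - Real.log (q a))

/-- Output distribution `W · q`. -/
def output {X Y : Type*} [Fintype X] (W : X → Y → ℝ) (q : X → ℝ) : Y → ℝ :=
  fun y => ∑ x, W x y * q x

/-- Joint distribution `W × q`. -/
def joint {X Y : Type*} (W : X → Y → ℝ) (q : X → ℝ) : X × Y → ℝ :=
  fun z => W z.1 z.2 * q z.1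

/-- Product distribution `q × r`. -/
def prodDist {X Y : Type*} (q : X → ℝ) (r : Y → ℝ) : X × Y → ℝ :=
  fun z => q z.1 * r z.2

/-- The mutual information `D(W × q ‖ q × (W · q))`. -/
def mutualInfo {X Y : Type*} [Fintype X] [Fintype Y] (W : X → Y → ℝ) (q : X → ℝ) : ℝ :=
  relEntropy (joint W q) (prodDist q (output W q))

/-- The channel capacity: the largest mutual information over all input distributions. -/
def capacity {X Y : Type*} [Fintype X] [Fintype Y] (W : X → Y → ℝ) : ℝ :=
  sSup (mutualInfo W '' stdSimplex ℝ X)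

/-! ### Exponential families attached to a channel

The input alphabet is `Fin (m + 1)` (so `n₁ = m + 1`), the output alphabet is `Fin (n + 1)`
(so `n₂ = n + 1`); the last input letter `Fin.last m` plays the role of `n₁`. A parameter in
`ℝ^(n₁ n₂ - 1)` is indexed by `Fin m ⊕ Fin (m + 1) × Fin n`. -/

variable {m n : ℕ}

/-- `h_{i,j} = ∑_y f_j(y) W_i(y)`, for all input letters `i`. -/
def hCoef (W : Fin (m + 1) → Fin (n + 1) → ℝ) (f : Fin n → Fin (n + 1) → ℝ)
    (i : Fin (m + 1)) (j : Fin n) : ℝ := ∑ y, f j y * W i y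

/-- The `(n₁ - 1) × (n₂ - 1)` matrix `H = (h_{i,j})`. -/
def hMat (W : Fin (m + 1) → Fin (n + 1) → ℝ) (f : Fin n → Fin (n + 1) → ℝ) :
    Matrix (Fin m) (Fin n) ℝ := Matrix.of fun i j => hCoef W f i.castSucc j

/-- `F_{E,a}(θ_a) = log ∑_x exp(∑_i θ^i δ_i(x))`. -/
def potA (θ : Fin m → ℝ) : ℝ :=
  Real.log (∑ x : Fin (m + 1), Real.exp (∑ i : Fin m, θ i * if x = i.castSucc then 1 else 0))

/-- `F_{E,b}(θ_b) = log ∑_y exp(∑_j θ^j f_j(y))`. -/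
def potB (f : Fin n → Fin (n + 1) → ℝ) (θ : Fin n → ℝ) : ℝ :=
  Real.log (∑ y, Real.exp (∑ j, θ j * f j y))

/-- The input distribution with parameter `θ_a`. -/
def distA (θ : Fin m → ℝ) : Fin (m + 1) → ℝ :=
  fun x => Real.exp ((∑ i : Fin m, θ i * if x = i.castSucc then 1 else 0) - potA θ)

/-- The output distribution with parameter `θ_b`. -/
def distB (f : Fin n → Fin (n + 1) → ℝ) (θ : Fin n → ℝ) : Fin (n + 1) → ℝ :=
  fun y => Real.exp ((∑ j, θ j * f j y) - potB f θ)

/-- The functions `ξ` on the product alphabet: `δ_i(x)` for `i ≠ n₁`, and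
`(f_j(y) - h_{i,j}) δ_i(x)` for all `i` (here `h_{n₁,j} = 0` by the choice of `f`). -/
def xi (W : Fin (m + 1) → Fin (n + 1) → ℝ) (f : Fin n → Fin (n + 1) → ℝ) :
    Fin m ⊕ Fin (m + 1) × Fin n → Fin (m + 1) × Fin (n + 1) → ℝ
  | Sum.inl i, z => if z.1 = i.castSucc then 1 else 0
  | Sum.inr (i, j), z => (f j z.2 - hCoef W f i j) * if z.1 = i then 1 else 0

/-- The potential `F(θ) = log ∑_{x,y} exp(∑_i θ^i ξ_i(x,y))`. -/
def pot (W : Fin (m + 1) → Fin (n + 1) → ℝ) (f : Fin n → Fin (n + 1) → ℝ)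
    (θ : Fin m ⊕ Fin (m + 1) × Fin n → ℝ) : ℝ :=
  Real.log (∑ z, Real.exp (∑ i, θ i * xi W f i z))

/-- The joint distribution `P_θ` on the product alphabet. -/
def distXY (W : Fin (m + 1) → Fin (n + 1) → ℝ) (f : Fin n → Fin (n + 1) → ℝ)
    (θ : Fin m ⊕ Fin (m + 1) × Fin n → ℝ) : Fin (m + 1) × Fin (n + 1) → ℝ :=
  fun z => Real.exp ((∑ i, θ i * xi W f i z) - pot W f θ)

/-- The matrix `V = (v_1, …, v_{n₁+n₂-2})`: with `u` the standard basis, `v_i = u_i` for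
`i = 1, …, n₁ - 1`, and the `j`-th of the other columns is
`∑_{i ≤ n₁} u_{(i,j)} + ∑_{i < n₁} h_{i,j} u_i`. -/
def vMat (W : Fin (m + 1) → Fin (n + 1) → ℝ) (f : Fin n → Fin (n + 1) → ℝ) :
    Matrix (Fin m ⊕ Fin (m + 1) × Fin n) (Fin m ⊕ Fin n) ℝ :=
  Matrix.fromBlocks 1 (hMat W f) 0 (Matrix.of fun p j => if p.2 = j then 1 else 0)

/-- The exponential family `E` generated by the columns of `V` at the origin
(the product distributions). -/
def famE (W : Fin (m + 1) → Fin (n + 1) → ℝ) (f : Fin n → Fin (n + 1) → ℝ) :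
    Set (Fin m ⊕ Fin (m + 1) × Fin n → ℝ) :=
  Set.range fun θ : Fin m ⊕ Fin n → ℝ => vMat W f *ᵥ θ

/-- The mixture family `M` given by the vanishing of the last `n₁ (n₂ - 1)` partial derivatives
of `F` (the joint distributions of the form `W × q`). -/
def famM (W : Fin (m + 1) → Fin (n + 1) → ℝ) (f : Fin n → Fin (n + 1) → ℝ) :
    Set (Fin m ⊕ Fin (m + 1) × Fin n → ℝ) :=
  {θ | ∀ p : Fin (m + 1) × Fin n, grad (pot W f) θ (Sum.inr p) = 0}

/-- The projected Bregman divergence `min_{θ' ∈ E} D^F(θ ‖ θ')`. -/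
def projDiv (W : Fin (m + 1) → Fin (n + 1) → ℝ) (f : Fin n → Fin (n + 1) → ℝ)
    (θ : Fin m ⊕ Fin (m + 1) × Fin n → ℝ) : ℝ :=
  sInf (bregman (pot W f) θ '' famE W f)

/-- `θ_b†` represents the channel:
`W_i(y) = exp(∑_j θ_b†^{(i,j)} (f_j(y) - h_{i,j})) / ∑_{y'} exp(∑_j θ_b†^{(i,j)} (f_j(y') - h_{i,j}))`. -/
def IsChannelParam (W : Fin (m + 1) → Fin (n + 1) → ℝ) (f : Fin n → Fin (n + 1) → ℝ)
    (θ : Fin (m + 1) × Fin n → ℝ) : Prop :=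
  ∀ i y, W i y = Real.exp (∑ j, θ (i, j) * (f j y - hCoef W f i j)) /
    ∑ y', Real.exp (∑ j, θ (i, j) * (f j y' - hCoef W f i j))

/-- `θ_a†`, with components `θ^{i,†} = H(W_{n₁}) - H(W_i)`, `i = 1, …, n₁ - 1`. -/
def daggerA (W : Fin (m + 1) → Fin (n + 1) → ℝ) : Fin m → ℝ :=
  fun i => entropy (W (Fin.last m)) - entropy (W i.castSucc)

/-- The affine family `E_b = {θ_b + G θ_c}`. -/
def famEb {k : ℕ} (θb : Fin n → ℝ) (G : Matrix (Fin n) (Fin k) ℝ) : Set (Fin n → ℝ) :=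
  Set.range fun θc : Fin k → ℝ => θb + G *ᵥ θc

/-- The mixture family `M_b = {θ_b | ∇F_{E,b}(θ_b) G = 0}`. -/
def famMb {k : ℕ} (f : Fin n → Fin (n + 1) → ℝ) (G : Matrix (Fin n) (Fin k) ℝ) :
    Set (Fin n → ℝ) :=
  {θ | grad (potB f) θ ᵥ* G = 0}

end

end ClassicalChannel

open ClassicalChannel

namespace ClassicalChannel

/-! ### Exponential families on a finite set -/

section ExpFamily

variable {ι Z : Type*} [Fintype ι] [Fintype Z]

/-! Put `s = distB f θbar` and `C = -entropy (W (Fin.last m)) + potB f θbar`. The equation `hMat W f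
*ᵥ θb = daggerA W`, which survives adding `G *ᵥ θc` because `H G = 0`, says that all rows of the
channel are equidistant from `s`: `D(W_x ‖ s) = C` (`relEntropy_row_distB`). The compensation
identity `∑ q(x) D(W_x ‖ s) = I(q) + D(W·q ‖ s)` (`sum_mul_relEntropy`) then gives `I(q) = C - D(W·q
‖ s)` for every input `q`. So an input with output `s` has mutual information `C`, and every other
one has less, since independent rows make `q ↦ W·q` injective.

The joint statements reduce to this one. The Bregman divergence of a log-partition function is
relative entropy (`bregman_expPot`), `famE` parametrizes product distributions, and members of
`famM` correspond to joints `W × q` with `q > 0`. By `bregman_vMat_mulVec` the divergence from `W ×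
q` to `r × t` is `I(q) + D(W·q ‖ t) + D(q ‖ r)`. Its minimum over `E` is `I(q)` once `W·q > 0`, so
maximizing over `M` is the capacity problem on positive inputs.

All identifications rest on `1, f_1, …, f_n` being a basis of the functions on the output alphabet:
moments and total mass determine a function, and every positive distribution has a unique parameter.
The minimizer over `θ_c` exists by coercivity and is unique because two critical points have zero
divergence from each other. -/

/-- The log-partition function of the exponential family with sufficient statistics `ξ`. -/
noncomputable def expPot (ξ : ι → Z → ℝ) (θ : ι → ℝ) : ℝ :=
  Real.log (∑ z, Real.exp (∑ i, θ i * ξ i z))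

/-- The member with parameter `θ` of the exponential family with sufficient statistics `ξ`. -/
noncomputable def expDist (ξ : ι → Z → ℝ) (θ : ι → ℝ) : Z → ℝ :=
  fun z => Real.exp ((∑ i, θ i * ξ i z) - expPot ξ θ)

theorem sum_exp_pos [Nonempty Z] (g : Z → ℝ) : 0 < ∑ z, Real.exp (g z) :=
  Finset.sum_pos (fun _ _ => Real.exp_pos _) Finset.univ_nonempty

theorem exp_expPot [Nonempty Z] (ξ : ι → Z → ℝ) (θ : ι → ℝ) :
    Real.exp (expPot ξ θ) = ∑ z, Real.exp (∑ i, θ i * ξ i z) :=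
  Real.exp_log (sum_exp_pos _)

theorem expDist_pos (ξ : ι → Z → ℝ) (θ : ι → ℝ) (z : Z) : 0 < expDist ξ θ z :=
  Real.exp_pos _

theorem log_expDist (ξ : ι → Z → ℝ) (θ : ι → ℝ) (z : Z) :
    Real.log (expDist ξ θ z) = (∑ i, θ i * ξ i z) - expPot ξ θ :=
  Real.log_exp _

theorem sum_expDist [Nonempty Z] (ξ : ι → Z → ℝ) (θ : ι → ℝ) : ∑ z, expDist ξ θ z = 1 := by
  simp only [expDist, Real.exp_sub, ← Finset.sum_div, exp_expPot]
  exact div_self (sum_exp_pos _).ne'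

theorem expDist_mem_stdSimplex [Nonempty Z] (ξ : ι → Z → ℝ) (θ : ι → ℝ) :
    expDist ξ θ ∈ stdSimplex ℝ Z :=
  ⟨fun z => (expDist_pos ξ θ z).le, sum_expDist ξ θ⟩

/-- A distribution whose logarithm is, up to a constant, a combination of the statistics is a
member of the exponential family. -/
theorem expDist_eq_of_log [Nonempty Z] (ξ : ι → Z → ℝ) (θ : ι → ℝ) {p : Z → ℝ}
    (hp : ∀ z, 0 < p z) (hp1 : ∑ z, p z = 1) {c : ℝ}
    (h : ∀ z, ∑ i, θ i * ξ i z = Real.log (p z) + c) : expDist ξ θ = p := by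
  have hc : expPot ξ θ = c := by
    simp only [expPot, h, Real.exp_add, Real.exp_log (hp _), ← Finset.sum_mul, hp1, one_mul,
      Real.log_exp]
  funext z
  rw [expDist, h, hc, add_sub_cancel_right, Real.exp_log (hp z)]

theorem hasFDerivAt_expPot [Nonempty Z] (ξ : ι → Z → ℝ) (θ : ι → ℝ) :
    HasFDerivAt (expPot ξ)
      (∑ z, expDist ξ θ z • ∑ i, ξ i z • (ContinuousLinearMap.proj i : (ι → ℝ) →L[ℝ] ℝ)) θ := by
  have h1 : ∀ z, HasFDerivAt (fun θ : ι → ℝ => ∑ i, θ i * ξ i z)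
      (∑ i, ξ i z • (ContinuousLinearMap.proj i : (ι → ℝ) →L[ℝ] ℝ)) θ := fun z =>
    HasFDerivAt.fun_sum fun i _ => (hasFDerivAt_apply i θ).mul_const (ξ i z)
  have h2 := (HasFDerivAt.fun_sum (u := Finset.univ) fun z _ => (h1 z).exp).log
    (sum_exp_pos fun z => ∑ i, θ i * ξ i z).ne'
  refine h2.congr_fderiv ?_
  rw [Finset.smul_sum]
  refine Finset.sum_congr rfl fun z _ => ?_
  rw [smul_smul, expDist, Real.exp_sub, exp_expPot, div_eq_inv_mul]

theorem continuous_expPot [Nonempty Z] (ξ : ι → Z → ℝ) : Continuous (expPot ξ) :=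
  continuous_iff_continuousAt.2 fun θ => (hasFDerivAt_expPot ξ θ).continuousAt

theorem fderiv_expPot_apply [Nonempty Z] (ξ : ι → Z → ℝ) (θ v : ι → ℝ) :
    fderiv ℝ (expPot ξ) θ v = ∑ z, expDist ξ θ z * ∑ i, v i * ξ i z := by
  simp [(hasFDerivAt_expPot ξ θ).fderiv, mul_comm]

variable [DecidableEq ι]

theorem grad_expPot [Nonempty Z] (ξ : ι → Z → ℝ) (θ : ι → ℝ) (j : ι) :
    grad (expPot ξ) θ j = ∑ z, expDist ξ θ z * ξ j z := by
  simp [grad, fderiv_expPot_apply, Pi.single_apply]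

theorem grad_expPot_dotProduct [Nonempty Z] (ξ : ι → Z → ℝ) (θ v : ι → ℝ) :
    grad (expPot ξ) θ ⬝ᵥ v = ∑ z, expDist ξ θ z * ∑ i, v i * ξ i z := by
  simp only [dotProduct, grad_expPot, Finset.sum_mul, Finset.mul_sum]
  rw [Finset.sum_comm]
  exact Finset.sum_congr rfl fun z _ => Finset.sum_congr rfl fun i _ => by ring

/-- The log-likelihood ratio is affine in the statistics, so its mean under `θ` only involves the
gradient and the two potentials. -/
theorem bregman_expPot [Nonempty Z] (ξ : ι → Z → ℝ) (θ θ' : ι → ℝ) :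
    bregman (expPot ξ) θ θ' = relEntropy (expDist ξ θ) (expDist ξ θ') := by
  simp only [bregman, relEntropy, grad_expPot_dotProduct, log_expDist, Pi.sub_apply, sub_mul,
    Finset.sum_sub_distrib, mul_sub, ← Finset.sum_mul, sum_expDist]
  ring

end ExpFamily

/-! ### Relative entropy -/

section RelEntropy

variable {α : Type*} [Fintype α]

/-- The added terms `q a - p a` sum to zero and make every summand nonnegative, so Gibbs' inequality
and its equality case can be read off termwise, even where `p` vanishes. -/
theorem relEntropy_eq_sum_klFun {p q : α → ℝ} (hp : ∑ a, p a = 1) (hq : ∀ a, 0 < q a)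
    (hq1 : ∑ a, q a = 1) :
    relEntropy p q = ∑ a, q a * InformationTheory.klFun (p a / q a) := by
  have h : ∀ a, q a * InformationTheory.klFun (p a / q a) =
      p a * (Real.log (p a) - Real.log (q a)) + (q a - p a) := fun a => by
    have := (hq a).ne'
    rcases eq_or_ne (p a) 0 with h0 | h0
    · simp [h0, InformationTheory.klFun]
    · rw [InformationTheory.klFun, Real.log_div h0 this]
      field_simp
      ring
  simp only [h, Finset.sum_add_distrib, Finset.sum_sub_distrib, hp, hq1, relEntropy]
  ring

theorem relEntropy_nonneg {p q : α → ℝ} (hp : p ∈ stdSimplex ℝ α) (hq : ∀ a, 0 < q a)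
    (hq1 : ∑ a, q a = 1) : 0 ≤ relEntropy p q := by
  rw [relEntropy_eq_sum_klFun hp.2 hq hq1]
  exact Finset.sum_nonneg fun a _ => mul_nonneg (hq a).le
    (InformationTheory.klFun_nonneg (div_nonneg (hp.1 a) (hq a).le))

theorem eq_of_relEntropy_eq_zero {p q : α → ℝ} (hp : p ∈ stdSimplex ℝ α) (hq : ∀ a, 0 < q a)
    (hq1 : ∑ a, q a = 1) (h : relEntropy p q = 0) : p = q := by
  rw [relEntropy_eq_sum_klFun hp.2 hq hq1, Finset.sum_eq_zero_iff_of_nonneg fun a _ =>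
    mul_nonneg (hq a).le (InformationTheory.klFun_nonneg (div_nonneg (hp.1 a) (hq a).le))] at h
  funext a
  have := (mul_eq_zero.1 (h a (Finset.mem_univ a))).resolve_left (hq a).ne'
  rw [InformationTheory.klFun_eq_zero_iff (div_nonneg (hp.1 a) (hq a).le)] at this
  exact (div_eq_one_iff_eq (hq a).ne').1 this

theorem relEntropy_pos {p q : α → ℝ} (hp : p ∈ stdSimplex ℝ α) (hq : ∀ a, 0 < q a)
    (hq1 : ∑ a, q a = 1) (h : p ≠ q) : 0 < relEntropy p q :=
  (relEntropy_nonneg hp hq hq1).lt_of_ne fun h0 => h (eq_of_relEntropy_eq_zero hp hq hq1 h0.symm)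

theorem relEntropy_self (p : α → ℝ) : relEntropy p p = 0 := by
  simp [relEntropy]

end RelEntropy

theorem convexOn_expPot {ι Z : Type*} [Fintype ι] [Fintype Z] [Nonempty Z] (ξ : ι → Z → ℝ) :
    ConvexOn ℝ Set.univ (expPot ξ) := by
  classical
  refine ⟨convex_univ, fun x _ y _ a b ha hb hab => ?_⟩
  -- Nonnegative divergence is the tangent inequality at the intermediate point; averaging it over
  -- `x` and `y` cancels the gradient.
  have key : ∀ θ, 0 ≤ bregman (expPot ξ) (a • x + b • y) θ := fun θ => by
    rw [bregman_expPot]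
    exact relEntropy_nonneg (expDist_mem_stdSimplex _ _) (expDist_pos _ _) (sum_expDist _ _)
  have h1 := mul_nonneg ha (key x)
  have h2 := mul_nonneg hb (key y)
  simp only [bregman, dotProduct_sub, dotProduct_add, dotProduct_smul, smul_eq_mul] at h1 h2 ⊢
  obtain rfl : b = 1 - a := by linarith
  linarith

/-! ### Mutual information -/

theorem output_injective {X Y : Type*} [Fintype X] {W : X → Y → ℝ}
    (hlin : LinearIndependent ℝ W) : Function.Injective (output W) := by
  intro p q h
  have h0 : ∑ x, (p x - q x) • W x = 0 := by
    funext y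
    have := congrFun h y
    simp only [output] at this
    simp only [sub_smul, Finset.sum_sub_distrib, Pi.sub_apply, Finset.sum_apply, Pi.smul_apply,
      smul_eq_mul, Pi.zero_apply]
    simp only [mul_comm (W _ _)] at this
    linarith
  funext x
  exact sub_eq_zero.1 (Fintype.linearIndependent_iff.1 hlin _ h0 x)

section Channel

variable {X Y : Type*} [Fintype X] [Fintype Y] {W : X → Y → ℝ}

theorem output_mem_stdSimplex (hW : ∀ x, W x ∈ stdSimplex ℝ Y) {q : X → ℝ}
    (hq : q ∈ stdSimplex ℝ X) : output W q ∈ stdSimplex ℝ Y := by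
  refine ⟨fun y => Finset.sum_nonneg fun x _ => mul_nonneg ((hW x).1 y) (hq.1 x), ?_⟩
  simp only [output]
  rw [Finset.sum_comm]
  simp [← Finset.sum_mul, (hW _).2, hq.2]

theorem output_pos (hW : ∀ x, W x ∈ stdSimplex ℝ Y) (hpos : ∀ y, ∃ x, 0 < W x y) {q : X → ℝ}
    (hq : ∀ x, 0 < q x) (y : Y) : 0 < output W q y := by
  obtain ⟨x, hx⟩ := hpos y
  exact Finset.sum_pos' (fun x _ => mul_nonneg ((hW x).1 y) (hq x).le)
    ⟨x, Finset.mem_univ x, mul_pos hx (hq x)⟩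

theorem relEntropy_joint_prodDist (hW : ∀ x, W x ∈ stdSimplex ℝ Y) (q : X → ℝ)
    {r : X → ℝ} {s : Y → ℝ} (hr : ∀ x, 0 < r x) (hs : ∀ y, 0 < s y) :
    relEntropy (joint W q) (prodDist r s) =
      ∑ x, q x * relEntropy (W x) s + relEntropy q r := by
  have h : ∀ x y, W x y * q x * (Real.log (W x y * q x) - Real.log (r x * s y)) =
      q x * (W x y * (Real.log (W x y) - Real.log (s y))) +
        W x y * (q x * (Real.log (q x) - Real.log (r x))) := fun x y => by
    rcases eq_or_ne (W x y) 0 with h0 | h0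
    · simp [h0]
    rcases eq_or_ne (q x) 0 with h1 | h1
    · simp [h1]
    rw [Real.log_mul h0 h1, Real.log_mul (hr x).ne' (hs y).ne']
    ring
  simp only [relEntropy, Fintype.sum_prod_type, joint, prodDist, h, Finset.sum_add_distrib,
    ← Finset.mul_sum, ← Finset.sum_mul, (hW _).2, one_mul]

/-- Insert `log (output W q y)` between `log (W x y)` and `log (s y)`. As `log (s y)` enters only
linearly, `s` need not be positive. -/
theorem sum_mul_relEntropy (hW : ∀ x, W x ∈ stdSimplex ℝ Y) {q : X → ℝ}
    (hq : q ∈ stdSimplex ℝ X) (s : Y → ℝ) :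
    ∑ x, q x * relEntropy (W x) s = mutualInfo W q + relEntropy (output W q) s := by
  have h : ∀ x y, q x * (W x y * (Real.log (W x y) - Real.log (s y))) =
      W x y * q x * (Real.log (W x y * q x) - Real.log (q x * output W q y)) +
        W x y * q x * (Real.log (output W q y) - Real.log (s y)) := fun x y => by
    rcases eq_or_ne (W x y) 0 with h0 | h0
    · simp [h0]
    rcases eq_or_ne (q x) 0 with h1 | h1
    · simp [h1]
    have h2 : output W q y ≠ 0 := fun h2 => by
      have := (Finset.sum_eq_zero_iff_of_nonneg fun x _ =>
        mul_nonneg ((hW x).1 y) (hq.1 x)).1 h2 x (Finset.mem_univ x)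
      exact (mul_ne_zero h0 h1) this
    rw [Real.log_mul h0 h1, Real.log_mul h1 h2]
    ring
  have h3 : relEntropy (output W q) s =
      ∑ x, ∑ y, W x y * q x * (Real.log (output W q y) - Real.log (s y)) := by
    rw [Finset.sum_comm]
    simp only [relEntropy, ← Finset.sum_mul]
    rfl
  rw [h3]
  simp only [mutualInfo, relEntropy, Fintype.sum_prod_type, joint, prodDist, Finset.mul_sum, h,
    Finset.sum_add_distrib]

/-- The mutual information of a channel all of whose rows are equidistant from `s`. -/
theorem mutualInfo_of_equidistant (hW : ∀ x, W x ∈ stdSimplex ℝ Y) {s : Y → ℝ} {C : ℝ}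
    (hC : ∀ x, relEntropy (W x) s = C) {q : X → ℝ} (hq : q ∈ stdSimplex ℝ X) :
    mutualInfo W q = C - relEntropy (output W q) s := by
  have h := sum_mul_relEntropy hW hq s
  simp only [hC, ← Finset.sum_mul, hq.2, one_mul] at h
  linarith

end Channel

/-! ### Coordinates with respect to `1, f_1, …, f_n` -/

section Coordinates

variable {n : ℕ} {f : Fin n → Fin (n + 1) → ℝ}

/-- The `n + 1` independent functions `1, f_1, …, f_n` live in a space of dimension `n + 1`, hence
span it. -/
theorem exists_const_add_sum (hf : LinearIndependent ℝ f)
    (hf_const : (fun _ => (1 : ℝ)) ∉ Submodule.span ℝ (Set.range f)) (g : Fin (n + 1) → ℝ) :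
    ∃ (c : ℝ) (θ : Fin n → ℝ), ∀ y, g y = c + ∑ j, θ j * f j y := by
  have hli := LinearIndependent.option hf hf_const
  have hspan := hli.span_eq_top_of_card_eq_finrank' (by simp)
  have hg : g ∈ Submodule.span ℝ (Set.range fun o : Option (Fin n) => o.casesOn'
      (fun _ => (1 : ℝ)) f) := hspan ▸ Submodule.mem_top
  obtain ⟨c, hc⟩ := (Submodule.mem_span_range_iff_exists_fun ℝ).1 hg
  refine ⟨c none, fun j => c (some j), fun y => ?_⟩
  rw [← hc]
  simp [Fintype.sum_option]

theorem eq_zero_of_sum_eq_const (hf : LinearIndependent ℝ f)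
    (hf_const : (fun _ => (1 : ℝ)) ∉ Submodule.span ℝ (Set.range f)) {d : Fin n → ℝ} {c : ℝ}
    (h : ∀ y, ∑ j, d j * f j y = c) : d = 0 := by
  have h' : ∑ j, d j • f j = fun _ => c := by
    funext y
    simp [h]
  have hc : c = 0 := by
    by_contra hc
    refine hf_const ?_
    have : (fun _ => (1 : ℝ)) = c⁻¹ • ∑ j, d j • f j := by
      rw [h']
      funext y
      simp [hc]
    rw [this]
    exact Submodule.smul_mem _ _ (Submodule.sum_mem _ fun j _ =>
      Submodule.smul_mem _ _ (Submodule.subset_span ⟨j, rfl⟩))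
  subst hc
  exact funext (Fintype.linearIndependent_iff.1 hf d h')

/-- The difference `p - q` is orthogonal to a basis, hence to itself. No signs are assumed, so this
also serves signed and unnormalized functions. -/
theorem eq_of_moments_eq (hf : LinearIndependent ℝ f)
    (hf_const : (fun _ => (1 : ℝ)) ∉ Submodule.span ℝ (Set.range f)) {p q : Fin (n + 1) → ℝ}
    (h1 : ∑ y, p y = ∑ y, q y) (h : ∀ j, ∑ y, p y * f j y = ∑ y, q y * f j y) : p = q := by
  obtain ⟨c, θ, hθ⟩ := exists_const_add_sum hf hf_const (p - q)
  have h0 : ∑ y, (p - q) y * (p - q) y = 0 := by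
    have : ∀ y, (p - q) y * (p - q) y =
        (p y - q y) * c + ∑ j, θ j * (p y * f j y - q y * f j y) := fun y => by
      nth_rw 2 [hθ]
      rw [mul_add, Finset.mul_sum, Pi.sub_apply]
      exact congrArg _ (Finset.sum_congr rfl fun j _ => by ring)
    simp only [this, Finset.sum_add_distrib, ← Finset.sum_mul, Finset.sum_sub_distrib, h1]
    rw [Finset.sum_comm]
    simp [← Finset.mul_sum, h]
  funext y
  have := (Finset.sum_eq_zero_iff_of_nonneg fun y _ => mul_self_nonneg ((p - q) y)).1 h0 y
    (Finset.mem_univ y)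
  exact sub_eq_zero.1 (mul_self_eq_zero.1 this)

theorem expDist_injective (hf : LinearIndependent ℝ f)
    (hf_const : (fun _ => (1 : ℝ)) ∉ Submodule.span ℝ (Set.range f)) :
    Function.Injective (expDist f) := by
  intro θ θ' h
  refine sub_eq_zero.1 (eq_zero_of_sum_eq_const hf hf_const (c := expPot f θ - expPot f θ') ?_)
  intro y
  have := congrArg Real.log (congrFun h y)
  simp only [log_expDist] at this
  simp only [Pi.sub_apply, sub_mul, Finset.sum_sub_distrib]
  linarith

end Coordinates

/-! ### The matrix `H` and the families on the output alphabet -/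

section Families

variable {m n : ℕ} {W : Fin (m + 1) → Fin (n + 1) → ℝ} {f : Fin n → Fin (n + 1) → ℝ}

theorem hMat_mulVec_apply (θ : Fin n → ℝ) (i : Fin m) :
    (hMat W f *ᵥ θ) i = ∑ y, W i.castSucc y * ∑ j, θ j * f j y := by
  simp only [Matrix.mulVec, dotProduct, hMat, Matrix.of_apply, hCoef, Finset.sum_mul,
    Finset.mul_sum]
  rw [Finset.sum_comm]
  exact Finset.sum_congr rfl fun y _ => Finset.sum_congr rfl fun j _ => by ring

theorem sum_last_mul (hf_last : ∀ j, ∑ y, f j y * W (Fin.last m) y = 0) (θ : Fin n → ℝ) :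
    ∑ y, W (Fin.last m) y * ∑ j, θ j * f j y = 0 := by
  simp only [Finset.mul_sum]
  rw [Finset.sum_comm]
  refine Finset.sum_eq_zero fun j _ => ?_
  rw [← mul_zero (θ j), ← hf_last j, Finset.mul_sum]
  exact Finset.sum_congr rfl fun y _ => by ring

/-- The centering of `f` under the last row makes the missing row of `H` zero, so the first `m`
weights already give all output moments. -/
theorem vecMul_hMat_apply (hf_last : ∀ j, ∑ y, f j y * W (Fin.last m) y = 0)
    (q : Fin (m + 1) → ℝ) (j : Fin n) :
    ((fun i : Fin m => q i.castSucc) ᵥ* hMat W f) j = ∑ y, output W q y * f j y := by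
  have h : ∑ y, output W q y * f j y = ∑ x, q x * hCoef W f x j := by
    simp only [output, hCoef, Finset.sum_mul, Finset.mul_sum]
    rw [Finset.sum_comm]
    exact Finset.sum_congr rfl fun y _ => Finset.sum_congr rfl fun j _ => by ring
  rw [h, Fin.sum_univ_castSucc, hCoef, hf_last, mul_zero, add_zero]
  rfl

theorem sum_output (hW : ∀ x, W x ∈ stdSimplex ℝ (Fin (n + 1))) (q : Fin (m + 1) → ℝ) :
    ∑ y, output W q y = ∑ x, q x := by
  simp only [output]
  rw [Finset.sum_comm]
  simp [← Finset.sum_mul, (hW _).2]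

theorem rank_hMat (hW : ∀ x, W x ∈ stdSimplex ℝ (Fin (n + 1))) (hlin : LinearIndependent ℝ W)
    (hf : LinearIndependent ℝ f)
    (hf_const : (fun _ => (1 : ℝ)) ∉ Submodule.span ℝ (Set.range f))
    (hf_last : ∀ j, ∑ y, f j y * W (Fin.last m) y = 0) : (hMat W f).rank = m := by
  have hinj : ∀ c : Fin m → ℝ, c ᵥ* hMat W f = 0 → c = 0 := by
    intro c hc
    -- The last entry is invisible to the moments, so it is free to make the total mass zero; then
    -- the output of `q` has the moments and mass of `0`.
    set q : Fin (m + 1) → ℝ := Fin.snoc c (-∑ i, c i) with hq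
    have hqc : (fun i : Fin m => q i.castSucc) = c := by
      funext i
      simp [hq]
    have h0 : output W q = output W 0 := by
      refine eq_of_moments_eq hf hf_const ?_ fun j => ?_
      · rw [sum_output hW, sum_output hW, Fin.sum_univ_castSucc]
        simp [hq]
      · rw [← vecMul_hMat_apply hf_last, hqc, hc]
        simp [output]
    have := output_injective hlin h0
    rw [← hqc, this]
    rfl
  have hrow : LinearIndependent ℝ (hMat W f).row := by
    rw [← Matrix.vecMul_injective_iff]
    intro a b hab
    refine sub_eq_zero.1 (hinj _ ?_)
    rw [Matrix.sub_vecMul, sub_eq_zero]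
    exact hab
  simpa using hrow.rank_matrix

/-- Rank–nullity: `ker H` has as many dimensions as `G` has columns. Rank `m` forces `m ≤ n`, so the
truncated `n - m` is the true difference. -/
theorem mulVec_injective_of_range_eq_ker {H : Matrix (Fin m) (Fin n) ℝ} (hH : H.rank = m)
    {G : Matrix (Fin n) (Fin (n - m)) ℝ}
    (hG : LinearMap.range G.mulVecLin = LinearMap.ker H.mulVecLin) :
    Function.Injective G.mulVecLin := by
  have h1 := H.mulVecLin.finrank_range_add_finrank_ker
  have h2 := G.mulVecLin.finrank_range_add_finrank_ker
  rw [hG] at h2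
  rw [Matrix.rank] at hH
  simp only [Module.finrank_fintype_fun_eq_card, Fintype.card_fin] at h1 h2
  rw [← LinearMap.ker_eq_bot, ← Submodule.finrank_eq_zero]
  omega

theorem mulVec_mulVec_eq_zero {k : ℕ} {H : Matrix (Fin m) (Fin n) ℝ}
    {G : Matrix (Fin n) (Fin k) ℝ}
    (hG : LinearMap.range G.mulVecLin = LinearMap.ker H.mulVecLin) (t : Fin k → ℝ) :
    H *ᵥ (G *ᵥ t) = 0 := by
  have : G.mulVecLin t ∈ LinearMap.ker H.mulVecLin := hG ▸ LinearMap.mem_range_self _ t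
  simpa using this

theorem sum_row_mul_eq (hf_last : ∀ j, ∑ y, f j y * W (Fin.last m) y = 0) {θ : Fin n → ℝ}
    (h : hMat W f *ᵥ θ = daggerA W) (x : Fin (m + 1)) :
    ∑ y, W x y * ∑ j, θ j * f j y = entropy (W (Fin.last m)) - entropy (W x) := by
  induction x using Fin.lastCases with
  | last => rw [sum_last_mul hf_last, sub_self]
  | cast i => rw [← hMat_mulVec_apply, h, daggerA]

/-- The `W x`-mean of the exponent is `entropy (W (Fin.last m)) - entropy (W x)`; its entropy of `W
x` cancels the one in the divergence, leaving nothing that depends on `x`. -/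
theorem relEntropy_row_distB (hW : ∀ x, W x ∈ stdSimplex ℝ (Fin (n + 1)))
    (hf_last : ∀ j, ∑ y, f j y * W (Fin.last m) y = 0) {θ : Fin n → ℝ}
    (h : hMat W f *ᵥ θ = daggerA W) (x : Fin (m + 1)) :
    relEntropy (W x) (distB f θ) = -entropy (W (Fin.last m)) + potB f θ := by
  have h1 := sum_row_mul_eq hf_last h x
  have h2 : ∀ y, Real.log (distB f θ y) = (∑ j, θ j * f j y) - potB f θ := log_expDist f θ
  simp only [relEntropy, h2, mul_sub, Finset.sum_sub_distrib, h1, ← Finset.sum_mul, (hW x).2]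
  simp only [entropy, Real.negMulLog, neg_mul, Finset.sum_neg_distrib]
  ring

/-- At a critical point the gradient term vanishes along the family, so divergences are differences
of potentials. The two opposite ones sum to zero, hence both vanish. -/
theorem famEb_inter_famMb_subsingleton (hf : LinearIndependent ℝ f)
    (hf_const : (fun _ => (1 : ℝ)) ∉ Submodule.span ℝ (Set.range f)) {k : ℕ} (θb : Fin n → ℝ)
    (G : Matrix (Fin n) (Fin k) ℝ) : (famEb θb G ∩ famMb f G).Subsingleton := by
  have key : ∀ s t : Fin k → ℝ, grad (potB f) (θb + G *ᵥ s) ᵥ* G = 0 →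
      relEntropy (distB f (θb + G *ᵥ s)) (distB f (θb + G *ᵥ t)) =
        potB f (θb + G *ᵥ t) - potB f (θb + G *ᵥ s) := fun s t h => by
    have h1 := bregman_expPot f (θb + G *ᵥ s) (θb + G *ᵥ t)
    rw [bregman, add_sub_add_left_eq_sub, ← Matrix.mulVec_sub, Matrix.dotProduct_mulVec] at h1
    change grad (potB f) _ ᵥ* G ⬝ᵥ _ - _ + _ = _ at h1
    rw [h, zero_dotProduct] at h1
    refine h1.symm.trans ?_
    rw [zero_sub, neg_add_eq_sub]
    rfl
  rintro _ ⟨⟨s, rfl⟩, hs⟩ _ ⟨⟨t, rfl⟩, ht⟩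
  have hpos : ∀ a b, 0 ≤ relEntropy (distB f a) (distB f b) := fun a b =>
    relEntropy_nonneg (expDist_mem_stdSimplex f a) (expDist_pos f b) (sum_expDist f b)
  have h1 := key s t hs
  have h2 := key t s ht
  have h3 := hpos (θb + G *ᵥ s) (θb + G *ᵥ t)
  have h4 := hpos (θb + G *ᵥ t) (θb + G *ᵥ s)
  exact expDist_injective hf hf_const (eq_of_relEntropy_eq_zero (expDist_mem_stdSimplex f _)
    (expDist_pos f _) (sum_expDist f _) (by change relEntropy (distB f _) (distB f _) = 0; linarith))

theorem mem_famMb_of_isMinOn {k : ℕ} {θb : Fin n → ℝ} {G : Matrix (Fin n) (Fin k) ℝ}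
    {θc : Fin k → ℝ} (h : IsMinOn (fun t => potB f (θb + G *ᵥ t)) Set.univ θc) :
    θb + G *ᵥ θc ∈ famMb f G := by
  have hloc : IsLocalMin (fun t => potB f (θb + G *ᵥ t)) θc := h.isLocalMin Filter.univ_mem
  have h1 : HasFDerivAt (fun t => θb + G *ᵥ t) (LinearMap.toContinuousLinearMap G.mulVecLin) θc :=
    (LinearMap.toContinuousLinearMap G.mulVecLin).hasFDerivAt.const_add θb
  have h2 : HasFDerivAt (potB f) (fderiv ℝ (potB f) (θb + G *ᵥ θc)) (θb + G *ᵥ θc) :=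
    (hasFDerivAt_expPot f _).differentiableAt.hasFDerivAt
  have h3 := hloc.hasFDerivAt_eq_zero (HasFDerivAt.comp (g := potB f) θc h2 h1)
  refine dotProduct_eq_zero _ fun v => ?_
  have h4 : fderiv ℝ (potB f) (θb + G *ᵥ θc) (G *ᵥ v) = 0 := DFunLike.congr_fun h3 v
  rw [← Matrix.dotProduct_mulVec]
  exact (grad_expPot_dotProduct f _ _).trans ((fderiv_expPot_apply f _ _).symm.trans h4)

/-! ### Coercivity and existence of the minimizer -/

theorem le_expPot {ι Z : Type*} [Fintype ι] [Fintype Z] (ξ : ι → Z → ℝ) (θ : ι → ℝ) (z : Z) :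
    ∑ i, θ i * ξ i z ≤ expPot ξ θ := by
  have : Nonempty Z := ⟨z⟩
  rw [← Real.exp_le_exp, exp_expPot]
  exact Finset.single_le_sum (f := fun z => Real.exp (∑ i, θ i * ξ i z))
    (fun z _ => (Real.exp_pos _).le) (Finset.mem_univ z)

/-- A function whose average with positive weights vanishes is controlled by an upper bound. -/
theorem exists_norm_le_of_sum_mul_eq_zero {α : Type*} [Fintype α] [Nonempty α] {w : α → ℝ}
    (hw : ∀ a, 0 < w a) : ∃ A > 0, ∀ (M : ℝ) (g : α → ℝ), ∑ a, w a * g a = 0 →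
      (∀ a, g a ≤ M) → ‖g‖ ≤ A * M := by
  obtain ⟨a₀, ha₀⟩ := Finite.exists_min w
  set S := ∑ a, w a
  have hS : 0 < S := Finset.sum_pos (fun a _ => hw a) Finset.univ_nonempty
  have hmin := hw a₀
  -- The deficits `M - g b` are nonnegative with weighted total `S * M`, so each is at most `S * M`
  -- over the smallest weight.
  refine ⟨1 + S / w a₀, by positivity, fun M g hg hM => ?_⟩
  have h1 : ∑ b, w b * (M - g b) = S * M := by
    simp only [mul_sub, Finset.sum_sub_distrib, ← Finset.sum_mul, hg, S, sub_zero]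
  have h2 : ∀ b, 0 ≤ M - g b := fun b => sub_nonneg.2 (hM b)
  have hM0 : 0 ≤ M := by
    refine nonneg_of_mul_nonneg_right (h1 ▸ ?_) hS
    exact Finset.sum_nonneg fun b _ => mul_nonneg (hw b).le (h2 b)
  refine (pi_norm_le_iff_of_nonneg (by positivity)).2 fun a => ?_
  rw [Real.norm_eq_abs, abs_le]
  constructor
  · have h3 : w a * (M - g a) ≤ S * M := h1 ▸ Finset.single_le_sum
      (f := fun b => w b * (M - g b)) (fun b _ => mul_nonneg (hw b).le (h2 b))
      (Finset.mem_univ a)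
    have h5 : M - g a ≤ S / w a₀ * M := by
      rw [div_mul_eq_mul_div, le_div_iff₀ hmin]
      linarith [mul_le_mul_of_nonneg_right (ha₀ a) (h2 a)]
    linarith
  · have : 0 ≤ S / w a₀ * M := by positivity
    linarith [hM a]

/-- Directions in `ker H` give exponents with mean zero under every row. Such an exponent cannot be
large in norm without being large and positive somewhere, and `potB` dominates the maximum of the
exponent: the objective is coercive. -/
theorem exists_isMinOn_potB (hW : ∀ x, W x ∈ stdSimplex ℝ (Fin (n + 1)))
    (hf : LinearIndependent ℝ f)
    (hf_last : ∀ j, ∑ y, f j y * W (Fin.last m) y = 0) (hpos : ∀ y, ∃ x, 0 < W x y)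
    {k : ℕ} (θb : Fin n → ℝ) {G : Matrix (Fin n) (Fin k) ℝ}
    (hG : ∀ t, hMat W f *ᵥ (G *ᵥ t) = 0) (hinj : Function.Injective G.mulVecLin) :
    ∃ θc, IsMinOn (fun t => potB f (θb + G *ᵥ t)) Set.univ θc := by
  let L : (Fin k → ℝ) →ₗ[ℝ] Fin (n + 1) → ℝ := (Fintype.linearCombination ℝ f).comp G.mulVecLin
  have hL : ∀ t y, L t y = ∑ j, (G *ᵥ t) j * f j y := fun t y => by
    simp [L, Fintype.linearCombination_apply]
  have hLinj : LinearMap.ker L = ⊥ := by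
    refine LinearMap.ker_eq_bot'.2 fun t ht => ?_
    have h0 : G *ᵥ t = 0 := funext (Fintype.linearIndependent_iff.1 hf _ ht)
    exact hinj ((G.mulVecLin_apply t).trans (h0.trans (map_zero _).symm))
  -- The input `1` gives the unnormalized sum of the rows, a strictly positive weight under which
  -- all `L t` have mean zero.
  have hw : ∀ y, 0 < output W 1 y := output_pos hW hpos fun _ => one_pos
  have hwL : ∀ t, ∑ y, output W 1 y * L t y = 0 := fun t => by
    simp only [output, Pi.one_apply, mul_one, Finset.sum_mul]
    rw [Finset.sum_comm]
    refine Finset.sum_eq_zero fun x _ => ?_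
    simp only [hL]
    induction x using Fin.lastCases with
    | last => exact sum_last_mul hf_last _
    | cast i => rw [← hMat_mulVec_apply, hG]; rfl
  obtain ⟨A, hA, hAle⟩ := exists_norm_le_of_sum_mul_eq_zero hw
  set g₀ : Fin (n + 1) → ℝ := fun y => ∑ j, θb j * f j y
  have hcont : Continuous fun t : Fin k → ℝ => potB f (θb + G *ᵥ t) :=
    (continuous_expPot f).comp (continuous_const.add (Continuous.matrix_mulVec continuous_const
      continuous_id))
  have hbound : ∀ t, A⁻¹ * ‖L t‖ - ‖g₀‖ ≤ potB f (θb + G *ᵥ t) := fun t => by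
    have h1 := hAle (potB f (θb + G *ᵥ t) + ‖g₀‖) (L t) (hwL t) fun y => by
      have h2 : ∑ j, (θb + G *ᵥ t) j * f j y ≤ potB f (θb + G *ᵥ t) := le_expPot f _ y
      have h3 := neg_le_of_abs_le (norm_le_pi_norm g₀ y)
      simp only [Pi.add_apply, add_mul, Finset.sum_add_distrib] at h2
      rw [hL]
      change -‖g₀‖ ≤ ∑ j, θb j * f j y at h3
      linarith
    rw [sub_le_iff_le_add, inv_mul_le_iff₀ hA]
    exact h1
  have hlim : Filter.Tendsto (fun t => potB f (θb + G *ᵥ t)) (Filter.cocompact _)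
      Filter.atTop := by
    refine Filter.tendsto_atTop_mono hbound ?_
    refine Filter.tendsto_atTop_add_const_right _ _ ?_
    refine Filter.Tendsto.const_mul_atTop (inv_pos.2 hA) ?_
    exact tendsto_norm_cocompact_atTop.comp
      (LinearMap.isClosedEmbedding_of_injective hLinj).tendsto_cocompact
  obtain ⟨t₀, ht₀⟩ := hcont.exists_forall_le hlim
  exact ⟨t₀, fun t _ => ht₀ t⟩

theorem existsUnique_isMinOn_potB (hW : ∀ x, W x ∈ stdSimplex ℝ (Fin (n + 1)))
    (hf : LinearIndependent ℝ f)
    (hf_const : (fun _ => (1 : ℝ)) ∉ Submodule.span ℝ (Set.range f))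
    (hf_last : ∀ j, ∑ y, f j y * W (Fin.last m) y = 0) (hpos : ∀ y, ∃ x, 0 < W x y)
    {k : ℕ} (θb : Fin n → ℝ) {G : Matrix (Fin n) (Fin k) ℝ}
    (hG : ∀ t, hMat W f *ᵥ (G *ᵥ t) = 0) (hinj : Function.Injective G.mulVecLin) :
    ∃! θc, IsMinOn (fun t => potB f (θb + G *ᵥ t)) Set.univ θc := by
  refine existsUnique_of_exists_of_unique
    (exists_isMinOn_potB hW hf hf_last hpos θb hG hinj) fun s t hs ht => hinj ?_
  exact add_left_cancel (famEb_inter_famMb_subsingleton hf hf_const θb G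
    ⟨⟨s, rfl⟩, mem_famMb_of_isMinOn hs⟩ ⟨⟨t, rfl⟩, mem_famMb_of_isMinOn ht⟩)

/-! ### The condition on the input parameter -/

theorem grad_potA (θ : Fin m → ℝ) : grad potA θ = fun i => distA θ i.castSucc := by
  funext i
  refine (grad_expPot (fun (i : Fin m) (x : Fin (m + 1)) => if x = i.castSucc then (1 : ℝ) else 0)
    θ i).trans ?_
  simp only [mul_ite, mul_one, mul_zero, Finset.sum_ite_eq', Finset.mem_univ, if_true]
  rfl

theorem distA_pos (θ : Fin m → ℝ) (x : Fin (m + 1)) : 0 < distA θ x := Real.exp_pos _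

theorem distB_pos (θ : Fin n → ℝ) (y : Fin (n + 1)) : 0 < distB f θ y := Real.exp_pos _

theorem distA_mem_stdSimplex (θ : Fin m → ℝ) : distA θ ∈ stdSimplex ℝ (Fin (m + 1)) :=
  expDist_mem_stdSimplex (fun (i : Fin m) (x : Fin (m + 1)) =>
    if x = i.castSucc then (1 : ℝ) else 0) θ

theorem distB_mem_stdSimplex (θ : Fin n → ℝ) : distB f θ ∈ stdSimplex ℝ (Fin (n + 1)) :=
  expDist_mem_stdSimplex f θ

/-- Both sides of the gradient equation are moment vectors of `f`, one of `distB f θb` and one of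
the output. -/
theorem grad_eq_iff_output_eq (hW : ∀ x, W x ∈ stdSimplex ℝ (Fin (n + 1)))
    (hf : LinearIndependent ℝ f)
    (hf_const : (fun _ => (1 : ℝ)) ∉ Submodule.span ℝ (Set.range f))
    (hf_last : ∀ j, ∑ y, f j y * W (Fin.last m) y = 0) (θb : Fin n → ℝ) (θa : Fin m → ℝ) :
    grad (potB f) θb = grad potA θa ᵥ* hMat W f ↔ output W (distA θa) = distB f θb := by
  have h1 : ∀ j, grad (potB f) θb j = ∑ y, distB f θb y * f j y := grad_expPot f θb
  rw [funext_iff, grad_potA]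
  simp only [h1, vecMul_hMat_apply hf_last]
  refine ⟨fun h => eq_of_moments_eq hf hf_const ?_ fun j => (h j).symm, fun h j => by rw [h]⟩
  rw [sum_output hW, (distA_mem_stdSimplex θa).2, (distB_mem_stdSimplex θb).2]

/-! ### Parameters of positive distributions and of the channel -/

theorem exists_distA_eq {q : Fin (m + 1) → ℝ} (hq : ∀ x, 0 < q x) (hq1 : ∑ x, q x = 1) :
    ∃ θ : Fin m → ℝ, distA θ = q := by
  refine ⟨fun i => Real.log (q i.castSucc) - Real.log (q (Fin.last m)),
    expDist_eq_of_log (fun (i : Fin m) (x : Fin (m + 1)) =>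
      if x = i.castSucc then (1 : ℝ) else 0) _ hq hq1 (c := -Real.log (q (Fin.last m)))
      fun x => ?_⟩
  induction x using Fin.lastCases with
  | last => simp [(Fin.castSucc_ne_last _).symm]
  | cast i => simp [sub_eq_add_neg]

theorem exists_distB_eq (hf : LinearIndependent ℝ f)
    (hf_const : (fun _ => (1 : ℝ)) ∉ Submodule.span ℝ (Set.range f)) {q : Fin (n + 1) → ℝ}
    (hq : ∀ x, 0 < q x) (hq1 : ∑ x, q x = 1) : ∃ θ : Fin n → ℝ, distB f θ = q := by
  obtain ⟨c, θ, h⟩ := exists_const_add_sum hf hf_const fun y => Real.log (q y)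
  exact ⟨θ, expDist_eq_of_log f θ hq hq1 (c := -c) fun y => by rw [h]; ring⟩

/-- Centering by `h` multiplies numerator and denominator by the same factor, so the condition
splits into one `distB` equation per row. -/
theorem existsUnique_isChannelParam (hW : ∀ x, W x ∈ stdSimplex ℝ (Fin (n + 1)))
    (hf : LinearIndependent ℝ f)
    (hf_const : (fun _ => (1 : ℝ)) ∉ Submodule.span ℝ (Set.range f)) (hpos : ∀ x y, 0 < W x y) :
    ∃! θ : Fin (m + 1) × Fin n → ℝ, IsChannelParam W f θ := by
  have key : ∀ θ : Fin (m + 1) × Fin n → ℝ, IsChannelParam W f θ ↔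
      ∀ i, distB f (fun j => θ (i, j)) = W i := fun θ => by
    refine forall_congr' fun i => ?_
    rw [funext_iff]
    refine forall_congr' fun y => ?_
    have h : ∀ y, ∑ j, θ (i, j) * (f j y - hCoef W f i j) =
        (∑ j, θ (i, j) * f j y) - ∑ j, θ (i, j) * hCoef W f i j := fun y => by
      simp only [mul_sub, Finset.sum_sub_distrib]
    simp only [h, Real.exp_sub, ← Finset.sum_div]
    rw [div_div_div_cancel_right₀ (Real.exp_pos _).ne', distB, Real.exp_sub]
    change _ ↔ _ / Real.exp (expPot f _) = _
    rw [exp_expPot, eq_comm]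
  choose η hη using fun i => exists_distB_eq hf hf_const (hpos i) (hW i).2
  refine ⟨fun p => η p.1 p.2, (key _).2 hη, fun θ hθ => ?_⟩
  funext ⟨i, j⟩
  have h1 : expDist f (fun j => θ (i, j)) = expDist f (η i) :=
    ((key θ).1 hθ i).trans (hη i).symm
  exact congrFun (expDist_injective hf hf_const h1) j

end Families

/-! ### The joint exponential family -/

section Joint

variable {m n : ℕ} {W : Fin (m + 1) → Fin (n + 1) → ℝ} {f : Fin n → Fin (n + 1) → ℝ}

theorem sum_mul_xi (θ : Fin m ⊕ Fin (m + 1) × Fin n → ℝ) (x : Fin (m + 1)) (y : Fin (n + 1)) :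
    ∑ i, θ i * xi W f i (x, y) = (∑ i : Fin m, θ (Sum.inl i) * if x = i.castSucc then 1 else 0) +
      ∑ j, θ (Sum.inr (x, j)) * (f j y - hCoef W f x j) := by
  rw [Fintype.sum_sum_type, Fintype.sum_prod_type]
  refine congrArg₂ _ rfl ?_
  rw [Fintype.sum_eq_single x fun x' hx' => ?_]
  · simp [xi]
  · simp [xi, hx'.symm]

theorem sum_mul_ite_eq_extend (η : Fin m → ℝ) (g : Fin (m + 1) → ℝ) (h0 : g (Fin.last m) = 0)
    (h : ∀ i, η i = g i.castSucc) (x : Fin (m + 1)) :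
    (∑ i : Fin m, η i * if x = i.castSucc then 1 else 0) = g x := by
  induction x using Fin.lastCases with
  | last => simp [(Fin.castSucc_ne_last _).symm, h0]
  | cast i => simp [h]

theorem distXY_injective (hf : LinearIndependent ℝ f)
    (hf_const : (fun _ => (1 : ℝ)) ∉ Submodule.span ℝ (Set.range f)) :
    Function.Injective (distXY W f) := by
  intro θ θ' h
  set d := θ - θ' with hd
  have h1 : ∀ x y, ∑ i, d i * xi W f i (x, y) = pot W f θ - pot W f θ' := fun x y => by
    have h2 : Real.log (expDist (xi W f) θ (x, y)) = Real.log (expDist (xi W f) θ' (x, y)) :=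
      congrArg Real.log (congrFun h (x, y))
    simp only [log_expDist] at h2
    simp only [hd, Pi.sub_apply, sub_mul, Finset.sum_sub_distrib]
    change _ = expPot (xi W f) θ - expPot (xi W f) θ'
    linarith
  simp only [sum_mul_xi] at h1
  have h2 : ∀ x j, d (Sum.inr (x, j)) = 0 := fun x j => by
    refine congrFun (eq_zero_of_sum_eq_const hf hf_const
      (d := fun j => d (Sum.inr (x, j))) (c := pot W f θ - pot W f θ' +
      (∑ j, d (Sum.inr (x, j)) * hCoef W f x j) -
      ∑ i : Fin m, d (Sum.inl i) * if x = i.castSucc then 1 else 0) fun y => ?_) j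
    have := h1 x y
    simp only [mul_sub, Finset.sum_sub_distrib] at this
    linarith
  simp only [h2, zero_mul, Finset.sum_const_zero, add_zero] at h1
  -- No `δ_i` is supported at the last letter, so the constant must vanish there.
  have h3 : pot W f θ - pot W f θ' = 0 := by
    rw [← h1 (Fin.last m) 0]
    simp [(Fin.castSucc_ne_last _).symm]
  refine sub_eq_zero.1 (funext fun i => ?_)
  rcases i with i | ⟨x, j⟩
  · have := h1 i.castSucc 0
    simpa [h3, hd] using this
  · exact h2 x j

/-- The block `hMat W f` in `V` compensates the centering of `f` in `xi`, leaving a sum of a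
function of `x` and a function of `y`. -/
theorem distXY_vMat_mulVec (hf_last : ∀ j, ∑ y, f j y * W (Fin.last m) y = 0) (θa : Fin m → ℝ)
    (θb : Fin n → ℝ) :
    distXY W f (vMat W f *ᵥ Sum.elim θa θb) = prodDist (distA θa) (distB f θb) := by
  have hV : ∀ x j, (vMat W f *ᵥ Sum.elim θa θb) (Sum.inr (x, j)) = θb j := fun x j => by
    simp [vMat, Matrix.mulVec, dotProduct]
  have hV' : ∀ i, (vMat W f *ᵥ Sum.elim θa θb) (Sum.inl i) = θa i + (hMat W f *ᵥ θb) i :=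
    fun i => by simp [vMat, Matrix.fromBlocks_mulVec]
  have hH : ∀ x : Fin (m + 1), (∑ i : Fin m, (hMat W f *ᵥ θb) i *
      if x = i.castSucc then 1 else 0) = ∑ j, θb j * hCoef W f x j := by
    refine sum_mul_ite_eq_extend _ (fun x => ∑ j, θb j * hCoef W f x j) ?_ fun i => ?_
    · simp [hCoef, hf_last]
    · simp [Matrix.mulVec, dotProduct, hMat, mul_comm]
  refine expDist_eq_of_log (xi W f) _ (fun z => mul_pos (distA_pos θa z.1) (distB_pos θb z.2)) ?_
    (c := potA θa + potB f θb) ?_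
  · simp only [Fintype.sum_prod_type, prodDist, ← Finset.mul_sum, (distB_mem_stdSimplex θb).2,
      mul_one, (distA_mem_stdSimplex θa).2]
  · rintro ⟨x, y⟩
    rw [sum_mul_xi, prodDist, Real.log_mul (distA_pos _ _).ne' (distB_pos _ _).ne', distA, distB,
      Real.log_exp, Real.log_exp]
    simp only [hV, hV', add_mul, Finset.sum_add_distrib, mul_sub, Finset.sum_sub_distrib, hH]
    ring

theorem grad_pot_inr (θ : Fin m ⊕ Fin (m + 1) × Fin n → ℝ) (x : Fin (m + 1)) (j : Fin n) :
    grad (pot W f) θ (Sum.inr (x, j)) =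
      (∑ y, distXY W f θ (x, y) * f j y) - (∑ y, distXY W f θ (x, y)) * hCoef W f x j := by
  refine (grad_expPot (xi W f) θ _).trans ?_
  rw [Fintype.sum_prod_type, Fintype.sum_eq_single x fun x' hx' => by simp [xi, hx']]
  simp only [xi, if_true, mul_one, mul_sub, Finset.sum_sub_distrib, ← Finset.sum_mul]
  rfl

theorem sum_joint_mul (q : Fin (m + 1) → ℝ) (x : Fin (m + 1)) (j : Fin n) :
    ∑ y, joint W q (x, y) * f j y = q x * hCoef W f x j := by
  rw [hCoef, Finset.mul_sum]
  exact Finset.sum_congr rfl fun y _ => by rw [joint]; ring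

theorem sum_joint (hW : ∀ x, W x ∈ stdSimplex ℝ (Fin (n + 1))) (q : Fin (m + 1) → ℝ)
    (x : Fin (m + 1)) : ∑ y, joint W q (x, y) = q x := by
  simp only [joint, ← Finset.sum_mul, (hW x).2, one_mul]

theorem mem_famM_of_distXY_eq_joint (hW : ∀ x, W x ∈ stdSimplex ℝ (Fin (n + 1)))
    {θ : Fin m ⊕ Fin (m + 1) × Fin n → ℝ} {q : Fin (m + 1) → ℝ}
    (h : distXY W f θ = joint W q) : θ ∈ famM W f := by
  rintro ⟨x, j⟩
  rw [grad_pot_inr, h, sum_joint hW, sum_joint_mul, sub_self]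

/-- With `q` the input marginal, the vanishing derivatives say that each slice `P(x, ·)` has the
moments of `q x • W x`; the masses agree too. -/
theorem exists_joint_of_mem_famM (hW : ∀ x, W x ∈ stdSimplex ℝ (Fin (n + 1)))
    (hf : LinearIndependent ℝ f)
    (hf_const : (fun _ => (1 : ℝ)) ∉ Submodule.span ℝ (Set.range f))
    {θ : Fin m ⊕ Fin (m + 1) × Fin n → ℝ} (h : θ ∈ famM W f) :
    ∃ q : Fin (m + 1) → ℝ, (∀ x, 0 < q x) ∧ ∑ x, q x = 1 ∧ distXY W f θ = joint W q := by
  set q : Fin (m + 1) → ℝ := fun x => ∑ y, distXY W f θ (x, y) with hq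
  refine ⟨q, fun x => sum_exp_pos _, ?_, ?_⟩
  · rw [hq, ← Fintype.sum_prod_type (f := distXY W f θ)]
    exact sum_expDist (xi W f) θ
  · funext ⟨x, y⟩
    refine congrFun (eq_of_moments_eq hf hf_const (p := fun y => distXY W f θ (x, y))
      (q := fun y => joint W q (x, y)) (sum_joint hW q x).symm fun j => ?_) y
    have h1 := h (x, j)
    rw [grad_pot_inr] at h1
    rw [sum_joint_mul]
    exact sub_eq_zero.1 h1

/-- Divergence of `W × q` from a product distribution of the family `E`. -/
theorem bregman_vMat_mulVec (hW : ∀ x, W x ∈ stdSimplex ℝ (Fin (n + 1)))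
    (hf_last : ∀ j, ∑ y, f j y * W (Fin.last m) y = 0)
    {θ : Fin m ⊕ Fin (m + 1) × Fin n → ℝ} {q : Fin (m + 1) → ℝ}
    (hq : q ∈ stdSimplex ℝ (Fin (m + 1))) (h : distXY W f θ = joint W q) (θa : Fin m → ℝ)
    (θb : Fin n → ℝ) :
    bregman (pot W f) θ (vMat W f *ᵥ Sum.elim θa θb) =
      mutualInfo W q + relEntropy (output W q) (distB f θb) + relEntropy q (distA θa) := by
  refine (bregman_expPot (xi W f) θ _).trans ?_
  change relEntropy (distXY W f θ) (distXY W f _) = _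
  rw [h, distXY_vMat_mulVec hf_last, relEntropy_joint_prodDist hW q (distA_pos θa) (distB_pos θb),
    sum_mul_relEntropy hW hq]

theorem isMinOn_bregman_famE (hW : ∀ x, W x ∈ stdSimplex ℝ (Fin (n + 1)))
    (hf_last : ∀ j, ∑ y, f j y * W (Fin.last m) y = 0)
    {θ : Fin m ⊕ Fin (m + 1) × Fin n → ℝ} {θa : Fin m → ℝ} {θb : Fin n → ℝ}
    (h : distXY W f θ = joint W (distA θa)) (hout : output W (distA θa) = distB f θb) :
    bregman (pot W f) θ (vMat W f *ᵥ Sum.elim θa θb) = mutualInfo W (distA θa) ∧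
      IsMinOn (bregman (pot W f) θ) (famE W f) (vMat W f *ᵥ Sum.elim θa θb) := by
  have h1 : bregman (pot W f) θ (vMat W f *ᵥ Sum.elim θa θb) = mutualInfo W (distA θa) := by
    rw [bregman_vMat_mulVec hW hf_last (distA_mem_stdSimplex θa) h, hout, relEntropy_self,
      relEntropy_self, add_zero, add_zero]
  refine ⟨h1, ?_⟩
  rintro _ ⟨η, rfl⟩
  change bregman _ _ _ ≤ bregman _ _ _
  rw [h1, ← Sum.elim_comp_inl_inr η,
    bregman_vMat_mulVec hW hf_last (distA_mem_stdSimplex θa) h]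
  have h2 : 0 ≤ relEntropy (distA θa) (distA (η ∘ Sum.inl)) := relEntropy_nonneg
    (distA_mem_stdSimplex θa) (distA_pos _) (distA_mem_stdSimplex _).2
  have h3 : 0 ≤ relEntropy (output W (distA θa)) (distB f (η ∘ Sum.inr)) := relEntropy_nonneg
    (output_mem_stdSimplex hW (distA_mem_stdSimplex θa)) (distB_pos _) (distB_mem_stdSimplex _).2
  linarith

theorem projDiv_eq_mutualInfo (hW : ∀ x, W x ∈ stdSimplex ℝ (Fin (n + 1)))
    (hf_last : ∀ j, ∑ y, f j y * W (Fin.last m) y = 0)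
    {θ : Fin m ⊕ Fin (m + 1) × Fin n → ℝ} {θa : Fin m → ℝ} {θb : Fin n → ℝ}
    (h : distXY W f θ = joint W (distA θa)) (hout : output W (distA θa) = distB f θb) :
    projDiv W f θ = mutualInfo W (distA θa) := by
  obtain ⟨h1, h2⟩ := isMinOn_bregman_famE hW hf_last h hout
  refine IsLeast.csInf_eq ⟨⟨_, ⟨_, rfl⟩, h1⟩, ?_⟩
  rintro _ ⟨η, hη, rfl⟩
  exact h1 ▸ h2 hη

/-- The centered exponent has mean zero under `W x`, so the log-normalizer of row `x` equals
`entropy (W x)`. Adding `daggerA W` thus replaces the row normalizers by one common constant. -/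
theorem IsChannelParam.distXY_eq_joint (hW : ∀ x, W x ∈ stdSimplex ℝ (Fin (n + 1)))
    {θb' : Fin (m + 1) × Fin n → ℝ} (h : IsChannelParam W f θb') (θa : Fin m → ℝ) :
    distXY W f (Sum.elim (θa + daggerA W) θb') = joint W (distA θa) := by
  have hpos : ∀ x y, 0 < W x y := fun x y => by
    rw [h x y]
    exact div_pos (Real.exp_pos _) (sum_exp_pos _)
  set Z : Fin (m + 1) → ℝ := fun x =>
    Real.log (∑ y', Real.exp (∑ j, θb' (x, j) * (f j y' - hCoef W f x j)))
  have hlog : ∀ x y, ∑ j, θb' (x, j) * (f j y - hCoef W f x j) = Real.log (W x y) + Z x :=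
    fun x y => by
      rw [h x y, Real.log_div (Real.exp_pos _).ne' (sum_exp_pos _).ne', Real.log_exp,
        sub_add_cancel]
  have hent : ∀ x, entropy (W x) = Z x := fun x => by
    have h1 : ∑ y, W x y * ∑ j, θb' (x, j) * (f j y - hCoef W f x j) = 0 := by
      simp only [Finset.mul_sum]
      rw [Finset.sum_comm]
      refine Finset.sum_eq_zero fun j _ => ?_
      have : ∀ y, W x y * (θb' (x, j) * (f j y - hCoef W f x j)) =
          θb' (x, j) * (f j y * W x y - W x y * hCoef W f x j) := fun y => by ring
      simp only [this, ← Finset.mul_sum, Finset.sum_sub_distrib, ← Finset.sum_mul, (hW x).2]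
      rw [hCoef, one_mul, sub_self, mul_zero]
    simp only [hlog, mul_add, Finset.sum_add_distrib, ← Finset.sum_mul, (hW x).2] at h1
    simp only [entropy, Real.negMulLog, neg_mul, Finset.sum_neg_distrib]
    linarith
  have hdag : ∀ x : Fin (m + 1), (∑ i : Fin m, daggerA W i * if x = i.castSucc then 1 else 0) =
      entropy (W (Fin.last m)) - Z x := fun x =>
    sum_mul_ite_eq_extend _ (fun x => entropy (W (Fin.last m)) - Z x) (by simp [hent])
      (fun i => by simp [daggerA, hent]) x
  refine expDist_eq_of_log (xi W f) _ (fun z => mul_pos (hpos z.1 z.2) (distA_pos θa z.1)) ?_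
    (c := entropy (W (Fin.last m)) + potA θa) ?_
  · rw [Fintype.sum_prod_type]
    simp only [sum_joint hW, (distA_mem_stdSimplex θa).2]
  · rintro ⟨x, y⟩
    rw [sum_mul_xi, joint, Real.log_mul (hpos x y).ne' (distA_pos _ _).ne', distA, Real.log_exp]
    simp only [Sum.elim_inl, Sum.elim_inr, Pi.add_apply, add_mul, Finset.sum_add_distrib, hdag,
      hlog]
    ring

theorem mutualInfo_lt_of_ne (hW : ∀ x, W x ∈ stdSimplex ℝ (Fin (n + 1)))
    (hlin : LinearIndependent ℝ W) {θa : Fin m → ℝ} {θb : Fin n → ℝ} {C : ℝ}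
    (hC : ∀ x, relEntropy (W x) (distB f θb) = C) (hout : output W (distA θa) = distB f θb)
    {q : Fin (m + 1) → ℝ} (hq : q ∈ stdSimplex ℝ (Fin (m + 1))) (hne : q ≠ distA θa) :
    mutualInfo W q < C := by
  rw [mutualInfo_of_equidistant hW hC hq]
  have := relEntropy_pos (output_mem_stdSimplex hW hq) (distB_pos (f := f) θb)
    (distB_mem_stdSimplex θb).2 fun h => hne (output_injective hlin (h.trans hout.symm))
  linarith

end Joint

end ClassicalChannel

theorem corollary4 (m n : ℕ)
    -- a channel with `n₁ = m + 1` inputs and `n₂ = n + 1` outputs, with linearly independent rows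
    (W : Fin (m + 1) → Fin (n + 1) → ℝ)
    (hW : ∀ x, W x ∈ stdSimplex ℝ (Fin (n + 1)))
    (hlin : LinearIndependent ℝ W)
    -- the generating functions on the output alphabet
    (f : Fin n → Fin (n + 1) → ℝ)
    (hf : LinearIndependent ℝ f)
    (hf_const : (fun _ => (1 : ℝ)) ∉ Submodule.span ℝ (Set.range f))
    (hf_last : ∀ j, ∑ y, f j y * W (Fin.last m) y = 0) :
    (hMat W f).rank = m ∧
    ConvexOn ℝ Set.univ (potB f) ∧
    ((∀ x y, 0 < W x y) → ∃! θb' : Fin (m + 1) × Fin n → ℝ, IsChannelParam W f θb') ∧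
    ∀ (θb : Fin n → ℝ), hMat W f *ᵥ θb = daggerA W →
    ∀ (G : Matrix (Fin n) (Fin (n - m)) ℝ),
      LinearMap.range G.mulVecLin = LinearMap.ker (hMat W f).mulVecLin →
    -- the convex minimization has exactly one solution when every output can occur
    ((∀ y, ∃ x, 0 < W x y) →
      ∃! θc : Fin (n - m) → ℝ, IsMinOn (fun t => potB f (θb + G *ᵥ t)) Set.univ θc) ∧
    ∀ (θc : Fin (n - m) → ℝ), IsMinOn (fun t => potB f (θb + G *ᵥ t)) Set.univ θc →
    ∀ (θbar : Fin n → ℝ), θbar = θb + G *ᵥ θc →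
      famEb θb G ∩ famMb f G = {θbar} ∧
      ∀ (θa : Fin m → ℝ),
        -- the two forms of the condition are equivalent
        (grad (potB f) θbar = grad potA θa ᵥ* hMat W f ↔
          output W (distA θa) = distB f θbar) ∧
        (output W (distA θa) = distB f θbar →
          -- the unique capacity-achieving input distribution, and the capacity
          distA θa ∈ stdSimplex ℝ (Fin (m + 1)) ∧
          (∀ q ∈ stdSimplex ℝ (Fin (m + 1)), q ≠ distA θa →
            mutualInfo W q < mutualInfo W (distA θa)) ∧
          mutualInfo W (distA θa) = -entropy (W (Fin.last m)) + potB f θbar ∧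
          capacity W = -entropy (W (Fin.last m)) + potB f θbar ∧
          -- the maximizer in the parametrization of the joint distributions
          ∀ (θb' : Fin (m + 1) × Fin n → ℝ), IsChannelParam W f θb' →
          ∀ (θs : Fin m ⊕ Fin (m + 1) × Fin n → ℝ), θs = Sum.elim (θa + daggerA W) θb' →
            θs ∈ famM W f ∧
            distXY W f θs = joint W (distA θa) ∧
            (∀ θ ∈ famM W f, θ ≠ θs → projDiv W f θ < projDiv W f θs) ∧
            projDiv W f θs = -entropy (W (Fin.last m)) + potB f θbar ∧
            IsMinOn (bregman (pot W f) θs) (famE W f) (vMat W f *ᵥ Sum.elim θa θbar) ∧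
            distXY W f (vMat W f *ᵥ Sum.elim θa θbar) =
              prodDist (distA θa) (distB f θbar) ∧
            relEntropy (distXY W f θs) (prodDist (distA θa) (distB f θbar)) =
              -entropy (W (Fin.last m)) + potB f θbar) := by
  have hrank := rank_hMat hW hlin hf hf_const hf_last
  refine ⟨hrank, convexOn_expPot f, existsUnique_isChannelParam hW hf hf_const, ?_⟩
  intro θb hθb G hG
  have hHG := mulVec_mulVec_eq_zero hG
  refine ⟨fun hpos => existsUnique_isMinOn_potB hW hf hf_const hf_last hpos θb hHG
    (mulVec_injective_of_range_eq_ker hrank hG), ?_⟩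
  rintro θc hθc θbar rfl
  refine ⟨(famEb_inter_famMb_subsingleton hf hf_const θb G).eq_singleton_of_mem
    ⟨⟨θc, rfl⟩, mem_famMb_of_isMinOn hθc⟩, ?_⟩
  set θbar := θb + G *ᵥ θc
  have hbar : hMat W f *ᵥ θbar = daggerA W := by
    rw [Matrix.mulVec_add, hHG, add_zero, hθb]
  have hC := relEntropy_row_distB hW hf_last hbar
  set C := -entropy (W (Fin.last m)) + potB f θbar
  intro θa
  refine ⟨grad_eq_iff_output_eq hW hf hf_const hf_last θbar θa, fun hout => ?_⟩
  have hmem := distA_mem_stdSimplex θa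
  have hval : mutualInfo W (distA θa) = C := by
    rw [mutualInfo_of_equidistant hW hC hmem, hout, relEntropy_self, sub_zero]
  have hlt : ∀ q ∈ stdSimplex ℝ (Fin (m + 1)), q ≠ distA θa →
      mutualInfo W q < mutualInfo W (distA θa) := fun q hq hne =>
    hval ▸ mutualInfo_lt_of_ne hW hlin hC hout hq hne
  refine ⟨hmem, hlt, hval, ?_, ?_⟩
  · rw [← hval]
    refine IsGreatest.csSup_eq ⟨⟨_, hmem, rfl⟩, ?_⟩
    rintro _ ⟨q, hq, rfl⟩
    rcases eq_or_ne q (distA θa) with rfl | hne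
    · exact le_rfl
    · exact (hlt q hq hne).le
  · rintro θb' hθb' θs rfl
    have hjoint := hθb'.distXY_eq_joint hW θa
    have hproj := projDiv_eq_mutualInfo hW hf_last hjoint hout
    obtain ⟨-, hmin⟩ := isMinOn_bregman_famE hW hf_last hjoint hout
    refine ⟨mem_famM_of_distXY_eq_joint hW hjoint, hjoint, fun θ hθ hne => ?_, hproj.trans hval,
      hmin, distXY_vMat_mulVec hf_last θa θbar, ?_⟩
    · obtain ⟨q, hq, hq1, hθq⟩ := exists_joint_of_mem_famM hW hf hf_const hθ
      -- A representable channel is strictly positive, so the output of `q` is positive and has a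
      -- parameter `ζ`; hence the minimum over `E` is attained and equals the mutual information.
      have hpos : ∀ y, ∃ x, 0 < W x y := fun y => ⟨0, by
        rw [hθb' 0 y]
        exact div_pos (Real.exp_pos _) (sum_exp_pos _)⟩
      obtain ⟨η, rfl⟩ := exists_distA_eq hq hq1
      obtain ⟨ζ, hζ⟩ := exists_distB_eq hf hf_const (output_pos hW hpos hq)
        (output_mem_stdSimplex hW (distA_mem_stdSimplex η)).2
      rw [hproj, projDiv_eq_mutualInfo hW hf_last hθq hζ.symm]
      refine hlt _ (distA_mem_stdSimplex η) fun h => hne (distXY_injective (W := W) hf hf_const ?_)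
      rw [hθq, h, hjoint]
    · rw [hjoint, relEntropy_joint_prodDist hW _ (distA_pos θa) (distB_pos θbar), relEntropy_self,
        add_zero]
      simp only [hC, ← Finset.sum_mul, hmem.2, one_mul]
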